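/- **Classical data compression with quantum side information at the decoder.** Let $X$ be a random variable on a finite alphabet $\mathcal X$ with distribution $(p_x)$, let $B$ be a finite-dimensional quantum system, let $\varphi_x^B$ ($x\in\mathcal X$) be density operators on $B$, and let $\psi^{XB}=\sum_x p_x|x\rangle\langle x|^X\otimes\varphi_x^B$. All logarithms are to base $2$, with $\log 0=-\infty$ and $\log\tfrac10=+\infty$. A protocol with $m$ bits consists of an encoder $\mathcal E:\mathcal X\to\{0,1\}^m$ and, for each $c\in\{0,1\}^m$, a POVM $(\Lambda_{x;c})_{x\in\mathcal X}$ on $B$ (the decoder); it is $\epsilon$-good if $1-\sum_x p_x\operatorname{Tr}[\Lambda_{x;\mathcal E(x)}\varphi_x^B]\le\epsilon$. Let $\ell_{\rm enc}^\epsilon(X|B)_\psi$ be the smallest $m$ for which an $\epsilon$-good protocol exists. For positive operators let $F(\rho,\sigma)=\|\sqrt\rho\sqrt\sigma\|_1$. Let $H_{\max}(A|B)_\rho=\max_{\sigma^B}2\log F(\rho^{AB},\mathbb 1^A\otimes\sigma^B)$, the maximum being over normalized states $\sigma^B$, and let $H_{\max}^\epsilon(A|B)_\rho=\min_{\bar\rho}H_{\max}(A|B)_{\bar\rho}$,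 the minimum being over all positive operators $\bar\rho^{AB}$ with $\operatorname{Tr}\bar\rho\le1$ and $\sqrt{1-F(\rho,\bar\rho)^2}\le\epsilon$. Then for every $\epsilon\ge0$: 1. (Achievability) if $\epsilon\le1$, then for all $\epsilon_1,\epsilon_2\ge0$ with $\epsilon_1<1$ and $\epsilon=\epsilon_1+\epsilon_2$, $$\ell_{\rm enc}^{\epsilon}(X|B)_\psi\le H_{\max}^{\epsilon_1}(X|B)_\psi+2\log\tfrac1{\epsilon_2}+4;$$ 2. (Converse) $$\ell_{\rm enc}^{\epsilon}(X|B)_\psi\ge H_{\max}^{\sqrt{2\epsilon}}(X|B)_\psi.$$ -/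

import Mathlib

open scoped Kronecker ComplexOrder MatrixOrder ENNReal

noncomputable section

namespace CQCompression

/-- Base-2 logarithm on `[0, ∞]`, with values in the extended reals
(`log₂ 0 = -∞` and `log₂ ∞ = +∞`). -/
def log2 (x : ℝ≥0∞) : EReal := ENNReal.log x / (Real.log 2 : EReal)

section Operators

variable {n : Type*} [Fintype n] [DecidableEq n]

/-- Density operators (normalized states). -/
def IsState (ρ : Matrix n n ℂ) : Prop := ρ.PosSemidef ∧ ρ.trace = 1

/-- Subnormalized states. -/
def IsSubState (ρ : Matrix n n ℂ) : Prop := ρ.PosSemidef ∧ ρ.trace.re ≤ 1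

/-- The trace norm `‖A‖₁ = Tr √(A† A)`. -/
def traceNorm (A : Matrix n n ℂ) : ℝ := (CFC.sqrt (A.conjTranspose * A)).trace.re

/-- The fidelity `F(ρ, σ) = ‖√ρ √σ‖₁` of positive operators. -/
def fidelity (ρ σ : Matrix n n ℂ) : ℝ := traceNorm (CFC.sqrt ρ * CFC.sqrt σ)

/-- The purification distance `P(ρ, σ) = √(1 - F(ρ, σ)²)`; only used when at least one of the
two arguments is normalized. -/
def purifDist (ρ σ : Matrix n n ℂ) : ℝ := Real.sqrt (1 - fidelity ρ σ ^ 2)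

/-- The ball `B_ε(ρ)` of subnormalized states around `ρ`. -/
def smoothBall (ε : ℝ) (ρ : Matrix n n ℂ) : Set (Matrix n n ℂ) :=
  {ρ' | IsSubState ρ' ∧ purifDist ρ ρ' ≤ ε}

end Operators

section Entropies

variable {A B : Type*} [Fintype A] [DecidableEq A] [Fintype B] [DecidableEq B]

/-- The conditional max-entropy
`H_max(A|B)_ρ = max_σ 2 log₂ F(ρ^{AB}, 1^A ⊗ σ^B)`, over normalized states `σ` of `B`. -/
def hmax (ρ : Matrix (A × B) (A × B) ℂ) : EReal :=
  ⨆ σ ∈ {σ : Matrix B B ℂ | IsState σ},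
    2 * log2 (ENNReal.ofReal (fidelity ρ ((1 : Matrix A A ℂ) ⊗ₖ σ)))

/-- The smooth conditional max-entropy `H_max^ε(A|B)_ρ`. -/
def hmaxSmooth (ε : ℝ) (ρ : Matrix (A × B) (A × B) ℂ) : EReal :=
  ⨅ ρ' ∈ smoothBall ε ρ, hmax ρ'

end Entropies

section Compression

variable {X B : Type*} [Fintype X] [DecidableEq X] [Fintype B] [DecidableEq B]

/-- The classical-quantum state `∑ₓ pₓ |x⟩⟨x| ⊗ φₓ`. -/
def cqState (p : X → ℝ) (φ : X → Matrix B B ℂ) : Matrix (X × B) (X × B) ℂ :=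
  ∑ x, (p x : ℂ) • (Matrix.single x x (1 : ℂ) ⊗ₖ φ x)

/-- POVMs on `B` with outcomes in `X`. -/
def IsPOVM (Λ : X → Matrix B B ℂ) : Prop :=
  (∀ x, (Λ x).PosSemidef) ∧ ∑ x, Λ x = 1

/-- Average error probability of the encoder `E` and the decoder that, on receiving `c`,
measures `B` with the operators `Λ c x`. -/
def errorProb {C : Type*} (p : X → ℝ) (φ : X → Matrix B B ℂ)
    (E : X → C) (Λ : C → X → Matrix B B ℂ) : ℝ :=
  1 - ∑ x, p x * (Λ (E x) x * φ x).trace.re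

/-- There is an `ε`-good protocol that compresses `X` to `m` bits. -/
def HasGoodProtocol (p : X → ℝ) (φ : X → Matrix B B ℂ) (ε : ℝ) (m : ℕ) : Prop :=
  ∃ (E : X → (Fin m → Bool)) (Λ : (Fin m → Bool) → X → Matrix B B ℂ),
    (∀ c, IsPOVM (Λ c)) ∧ errorProb p φ E Λ ≤ ε

/-- `ℓ_enc^ε(X|B)_ψ`: the smallest number of bits of an `ε`-good protocol
(`+∞` if there were none). -/
def lenc (p : X → ℝ) (φ : X → Matrix B B ℂ) (ε : ℝ) : EReal :=
  ⨅ m ∈ {m : ℕ | HasGoodProtocol p φ ε m}, ((m : ℝ) : EReal)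

end Compression

end CQCompression

end

/-! Achievability. Let `ρ` be any operator in the smoothing ball around `ψ`. Its fidelity with `ψ`
is attained by a contraction `K`, so it equals `Re Tr(√ψ √ρ K)`. Since `ψ` is block diagonal, only
the diagonal blocks `N x` of `√ρ K` matter. The operators `ω x = N x (N x)ᴴ` form a subnormalized
ensemble whose test probabilities fall short of those of `ψ` by at most `ε₁` on any family of
effects `0 ≤ T x ≤ 1`, and `∑ Tr(√(ω x) √σ)` is at most the fidelity of `ρ` with `1 ⊗ σ`
(`exists_blockDiag_near`). This ensemble is coded by hashing `x` with a uniformly random function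
into `C`. The decoder is a pretty good measurement built from the projections onto the positive part
of `ω x - (2/|C|) ω_B`, where `ω_B = ∑ ω y`. The Hayashi-Nagaoka inequality (`one_sub_conj_le`) and
the Chernoff bound at `1/2` (`exists_projection_trace_le`) bound the average error by `2 ∑ Tr(√(ω x)
√((2/|C|) ω_B))` (`exists_code`). With `σ` the normalized `ω_B`, this is at most `2 √(2/2^m)` times
the fidelity of `ρ` with `1 ⊗ σ`, hence at most `ε₂` for the right `m`.

Converse. Let `L` be block diagonal with the blocks of the decoder that announce the correct symbol.
Then `L ψ L` is close to `ψ`, and completeness of the `|C|` POVMs bounds its fidelity with every `1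
⊗ σ` by `√|C|` (`exists_near_fidelity_le`). -/

namespace CQCompression

set_option linter.unusedSectionVars false

/-! ### Matrix inequalities: polar decomposition, trace norm, Chernoff and Hayashi-Nagaoka bounds -/

section MatrixInequalities

open Matrix

variable {n : Type*} [Fintype n] [DecidableEq n]

open scoped Matrix.Norms.L2Operator in
theorem sqrt_mono {A B : Matrix n n ℂ} (h : A ≤ B) : CFC.sqrt A ≤ CFC.sqrt B :=
  CFC.sqrt_le_sqrt A B h

theorem sqrt_conjTranspose (A : Matrix n n ℂ) : (CFC.sqrt A)ᴴ = CFC.sqrt A :=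
  (CFC.sqrt_nonneg A).isSelfAdjoint

theorem conjTranspose_mul_self_nonneg (A : Matrix n n ℂ) : 0 ≤ Aᴴ * A :=
  (posSemidef_conjTranspose_mul_self A).nonneg

theorem self_mul_conjTranspose_nonneg (A : Matrix n n ℂ) : 0 ≤ A * Aᴴ :=
  (posSemidef_self_mul_conjTranspose A).nonneg

theorem conj_mono {A B : Matrix n n ℂ} (h : A ≤ B) (K : Matrix n n ℂ) :
    Kᴴ * A * K ≤ Kᴴ * B * K :=
  star_left_conjugate_le_conjugate h K

theorem trace_re_mono {A B : Matrix n n ℂ} (h : A ≤ B) : A.trace.re ≤ B.trace.re := by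
  have h1 : 0 ≤ (B - A).trace := (le_iff.mp h).trace_nonneg
  have h2 := (Complex.le_def.mp h1).1
  rw [trace_sub] at h2
  simpa using h2

theorem trace_re_nonneg {A : Matrix n n ℂ} (h : 0 ≤ A) : 0 ≤ A.trace.re := by
  simpa using trace_re_mono h

theorem trace_conjTranspose_re (A : Matrix n n ℂ) : Aᴴ.trace.re = A.trace.re := by
  simp [trace_conjTranspose]

theorem trace_mul_sqrt_conj {A : Matrix n n ℂ} (hA : 0 ≤ A) (B : Matrix n n ℂ) :
    (A * B).trace = ((CFC.sqrt A)ᴴ * B * CFC.sqrt A).trace := by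
  conv_lhs => rw [← CFC.sqrt_mul_sqrt_self A hA]
  rw [sqrt_conjTranspose, Matrix.mul_assoc, trace_mul_comm]

theorem trace_mul_re_mono {A B C : Matrix n n ℂ} (hA : 0 ≤ A) (h : B ≤ C) :
    (A * B).trace.re ≤ (A * C).trace.re := by
  rw [trace_mul_sqrt_conj hA, trace_mul_sqrt_conj hA]
  exact trace_re_mono (conj_mono h _)

theorem trace_mul_re_nonneg {A B : Matrix n n ℂ} (hA : 0 ≤ A) (hB : 0 ≤ B) :
    0 ≤ (A * B).trace.re := by
  simpa using trace_mul_re_mono hA hB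

theorem trace_conjTranspose_mul_self_nonneg (A : Matrix n n ℂ) : 0 ≤ (Aᴴ * A).trace.re :=
  trace_re_nonneg (conjTranspose_mul_self_nonneg A)

/-- The Cauchy-Schwarz inequality for the Hilbert-Schmidt inner product. -/
theorem trace_conjTranspose_mul_re_sq_le (X Y : Matrix n n ℂ) :
    (Xᴴ * Y).trace.re ^ 2 ≤ (Xᴴ * X).trace.re * (Yᴴ * Y).trace.re := by
  have key : ∀ s : ℝ, 0 ≤ (Xᴴ * X).trace.re * (s * s) + 2 * (Xᴴ * Y).trace.re * s
      + (Yᴴ * Y).trace.re := by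
    intro s
    have h := trace_conjTranspose_mul_self_nonneg ((s : ℂ) • X + Y)
    have e : (Yᴴ * X).trace.re = (Xᴴ * Y).trace.re := by
      rw [← trace_conjTranspose_re, conjTranspose_mul, conjTranspose_conjTranspose]
    simp only [conjTranspose_add, conjTranspose_smul, Matrix.add_mul, Matrix.mul_add,
      Matrix.smul_mul, Matrix.mul_smul, trace_add, trace_smul, Complex.add_re, smul_eq_mul,
      Complex.star_def, Complex.conj_ofReal, Complex.re_ofReal_mul, e] at h
    linarith
  have := discrim_le_zero key
  unfold discrim at this
  linarith

theorem trace_conjTranspose_mul_re_le (X Y : Matrix n n ℂ) :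
    (Xᴴ * Y).trace.re ≤ √((Xᴴ * X).trace.re) * √((Yᴴ * Y).trace.re) := by
  rw [← Real.sqrt_mul (trace_conjTranspose_mul_self_nonneg X)]
  exact Real.le_sqrt_of_sq_le (trace_conjTranspose_mul_re_sq_le X Y)

/-- Contractions: matrices of operator norm at most one. -/
def IsContraction (K : Matrix n n ℂ) : Prop := Kᴴ * K ≤ 1

open scoped Matrix.Norms.L2Operator in
theorem isContraction_iff_norm_le_one (K : Matrix n n ℂ) : IsContraction K ↔ ‖K‖ ≤ 1 := by
  unfold IsContraction
  rw [← CStarAlgebra.norm_le_one_iff_of_nonneg (Kᴴ * K) (conjTranspose_mul_self_nonneg K),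
    l2_opNorm_conjTranspose_mul_self]
  constructor <;> intro h <;> nlinarith [norm_nonneg K]

open scoped Matrix.Norms.L2Operator in
theorem IsContraction.conjTranspose {K : Matrix n n ℂ} (hK : IsContraction K) :
    IsContraction Kᴴ := by
  rw [isContraction_iff_norm_le_one] at hK ⊢
  rwa [l2_opNorm_conjTranspose]

theorem IsContraction.mul {K L : Matrix n n ℂ} (hK : IsContraction K) (hL : IsContraction L) :
    IsContraction (K * L) := by
  have h := conj_mono hK L
  unfold IsContraction at hL ⊢
  rw [conjTranspose_mul]
  calc Lᴴ * Kᴴ * (K * L) = Lᴴ * (Kᴴ * K) * L := by noncomm_ring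
    _ ≤ Lᴴ * 1 * L := h
    _ ≤ 1 := by simpa using hL

/-- `G` is the inverse square root of `S` on its support. The convention `0⁻¹ = 0` makes it vanish
on the kernel, so `G * S * G` is the support projection. -/
theorem exists_invSqrt {S : Matrix n n ℂ} (hS : 0 ≤ S) :
    ∃ G : Matrix n n ℂ, Gᴴ = G ∧ G * S = CFC.sqrt S ∧ S * G = CFC.sqrt S ∧ G * S * G ≤ 1 := by
  have hc : ∀ f : ℝ → ℝ, ContinuousOn f (spectrum ℝ S) := fun f =>
    (Matrix.finite_real_spectrum (A := S)).continuousOn f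
  have hsa : IsSelfAdjoint S := hS.isSelfAdjoint
  have e1 : ∀ f : ℝ → ℝ, cfc f S * S = cfc (fun x => f x * x) S := fun f => by
    conv_lhs => rw [← cfc_id' ℝ S]
    rw [cfc_mul f _ S (hc _) (hc _), cfc_id' ℝ S]
  have e2 : ∀ f : ℝ → ℝ, S * cfc f S = cfc (fun x => x * f x) S := fun f => by
    rw [cfc_mul _ f S (hc _) (hc _), cfc_id' ℝ S]
  have e3 : CFC.sqrt S = cfc Real.sqrt S := by
    rw [CFC.sqrt_eq_real_sqrt S, cfcₙ_eq_cfc]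
  have hx : ∀ x : ℝ, (√x)⁻¹ * x = √x := fun x => by
    by_cases h : 0 < x
    · field_simp; rw [Real.sq_sqrt h.le]
    · rw [Real.sqrt_eq_zero_of_nonpos (not_lt.mp h)]; simp
  refine ⟨cfc (fun x : ℝ => (√x)⁻¹) S, (cfc_predicate _ S : IsSelfAdjoint _), ?_, ?_, ?_⟩
  · rw [e1, e3]; exact cfc_congr fun x _ => hx x
  · rw [e2, e3]; exact cfc_congr fun x _ => (mul_comm _ _).trans (hx x)
  · rw [e1, ← cfc_mul _ _ S (hc _) (hc _)]
    refine cfc_le_one _ _ fun x _ => ?_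
    rw [hx]
    exact mul_inv_le_one

/-- The polar decomposition, with a contraction in place of a unitary. -/
theorem exists_polar (A : Matrix n n ℂ) :
    ∃ W : Matrix n n ℂ, IsContraction W ∧ Wᴴ * A = CFC.sqrt (Aᴴ * A) ∧
      A = W * CFC.sqrt (Aᴴ * A) := by
  obtain ⟨G, hG, hGS, hSG, hle⟩ := exists_invSqrt (conjTranspose_mul_self_nonneg A)
  have hR := CFC.sqrt_mul_sqrt_self (Aᴴ * A) (conjTranspose_mul_self_nonneg A)
  have hRt := sqrt_conjTranspose (Aᴴ * A)
  set R := CFC.sqrt (Aᴴ * A)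
  -- `G` is the pseudo-inverse of `|A| = R`, so `A * G` is the partial isometry of the polar
  -- decomposition.
  refine ⟨A * G, ?_, ?_, ?_⟩
  · unfold IsContraction
    rw [conjTranspose_mul, hG]
    simpa only [Matrix.mul_assoc] using hle
  · rw [conjTranspose_mul, hG, Matrix.mul_assoc, hGS]
  · rw [← sub_eq_zero, ← conjTranspose_mul_self_eq_zero]
    have h1 : Aᴴ * A * G * R = Aᴴ * A := by rw [hSG, hR]
    have h2 : R * G * Aᴴ * A = Aᴴ * A := by
      rw [Matrix.mul_assoc _ _ A, Matrix.mul_assoc R, hGS, hR]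
    have e : (A - A * G * R)ᴴ * (A - A * G * R)
        = Aᴴ * A - Aᴴ * A * G * R - R * G * Aᴴ * A + R * G * Aᴴ * A * G * R := by
      rw [conjTranspose_sub, conjTranspose_mul, conjTranspose_mul, hG, hRt]
      noncomm_ring
    rw [e, h2, h1]
    simp

/-- Half of the variational formula for the trace norm over contractions;
`exists_contraction_traceNorm` is the other half. Split `|A|` into two square roots and apply
Cauchy-Schwarz. -/
theorem trace_mul_re_le_traceNorm {K : Matrix n n ℂ} (hK : IsContraction K) (A : Matrix n n ℂ) :
    (K * A).trace.re ≤ traceNorm A := by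
  obtain ⟨W, hW, -, hA⟩ := exists_polar A
  unfold traceNorm
  set R := CFC.sqrt (Aᴴ * A) with hRdef
  have hR0 : 0 ≤ R := CFC.sqrt_nonneg _
  have hr := CFC.sqrt_mul_sqrt_self R hR0
  have hrt := sqrt_conjTranspose R
  set r := CFC.sqrt R
  have h1 : (K * A).trace = (rᴴ * (K * W * r)).trace := by
    rw [hA, ← hr, hrt, trace_mul_comm r]
    congr 1
    noncomm_ring
  have h2 : ((K * W * r)ᴴ * (K * W * r)).trace.re ≤ R.trace.re := by
    have h := conj_mono (hK.mul hW) r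
    rw [hrt, Matrix.mul_one, hr] at h
    refine trace_re_mono (le_trans (le_of_eq ?_) h)
    rw [conjTranspose_mul (K * W), hrt]
    noncomm_ring
  rw [h1]
  refine (trace_conjTranspose_mul_re_le _ _).trans ?_
  rw [hrt, hr]
  calc _ ≤ √(R.trace.re) * √(R.trace.re) := by gcongr
    _ = _ := Real.mul_self_sqrt (trace_re_nonneg hR0)

theorem exists_contraction_traceNorm (A : Matrix n n ℂ) :
    ∃ K : Matrix n n ℂ, IsContraction K ∧ (K * A).trace.re = traceNorm A := by
  obtain ⟨W, hW, hA, -⟩ := exists_polar A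
  exact ⟨Wᴴ, hW.conjTranspose, by rw [hA]; rfl⟩

theorem trace_mul_re_le_fidelity {K : Matrix n n ℂ} (hK : IsContraction K)
    (ρ σ : Matrix n n ℂ) : (K * CFC.sqrt ρ * CFC.sqrt σ).trace.re ≤ fidelity ρ σ := by
  rw [Matrix.mul_assoc]
  exact trace_mul_re_le_traceNorm hK _

theorem trace_sqrt_mul_sqrt_mul_re_le_fidelity {K : Matrix n n ℂ} (hK : IsContraction K)
    (ρ σ : Matrix n n ℂ) : (CFC.sqrt σ * CFC.sqrt ρ * K).trace.re ≤ fidelity ρ σ := by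
  rw [← trace_conjTranspose_re, conjTranspose_mul, conjTranspose_mul, sqrt_conjTranspose,
    sqrt_conjTranspose, ← Matrix.mul_assoc]
  exact trace_mul_re_le_fidelity hK.conjTranspose ρ σ

theorem fidelity_nonneg (ρ σ : Matrix n n ℂ) : 0 ≤ fidelity ρ σ :=
  trace_re_nonneg (CFC.sqrt_nonneg _)

/-- The projection onto the positive part of `A - B` discriminates `A` from `B` with an error
bounded by the Chernoff quantity at `1/2`. -/
theorem exists_projection_trace_le {A B : Matrix n n ℂ} (hA : 0 ≤ A) (hB : 0 ≤ B) :
    ∃ P : Matrix n n ℂ, 0 ≤ P ∧ P * P = P ∧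
      ((1 - P) * A).trace.re + (P * B).trace.re ≤ (CFC.sqrt A * CFC.sqrt B).trace.re := by
  set D := A - B with hD
  have hc : ∀ f : ℝ → ℝ, ContinuousOn f (spectrum ℝ D) := fun f =>
    (Matrix.finite_real_spectrum (A := D)).continuousOn f
  have hsa : IsSelfAdjoint D := hA.isSelfAdjoint.sub hB.isSelfAdjoint
  let f : ℝ → ℝ := fun x => if 0 < x then 1 else 0
  have hf : ∀ x, 0 ≤ f x := fun x => by dsimp only [f]; split_ifs <;> norm_num
  have e1 : cfc f D * D = cfc (fun x => f x * x) D := by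
    conv_lhs => rw [← cfc_id' ℝ D]
    rw [cfc_mul f _ D (hc _) (hc _), cfc_id' ℝ D]
  have hC0 : 0 ≤ cfc f D * D := by
    rw [e1]
    refine cfc_nonneg fun x _ => ?_
    dsimp only [f]
    split_ifs with h
    · linarith
    · simp
  have hC : D ≤ cfc f D * D := by
    rw [e1]
    conv_lhs => rw [← cfc_id' ℝ D]
    refine cfc_mono (fun x _ => ?_) (hc _) (hc _)
    dsimp only [f]
    split_ifs with h
    · linarith
    · linarith
  refine ⟨cfc f D, cfc_nonneg fun x _ => hf x, ?_, ?_⟩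
  · rw [← cfc_mul _ _ D (hc _) (hc _)]
    exact cfc_congr fun x _ => by dsimp only [f]; split_ifs <;> norm_num
  set P := cfc f D
  set C := P * D with hCdef
  -- `C` is the positive part of `A - B`, so `B + C` dominates both operators. Monotonicity of the
  -- square root then gives `Tr a(a - b) ≤ Tr c(c - b) ≤ Tr C`, with `a`, `b`, `c` the three roots.
  have hAC : A ≤ B + C := by
    have := add_le_add_right hC B
    simpa [hD] using this
  have hBC : B ≤ B + C := le_add_of_nonneg_right hC0
  have hBC0 : 0 ≤ B + C := hB.trans hBC
  set a := CFC.sqrt A with ha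
  set b := CFC.sqrt B with hb
  set c := CFC.sqrt (B + C) with hcd
  have haa : a * a = A := CFC.sqrt_mul_sqrt_self A hA
  have hbb : b * b = B := CFC.sqrt_mul_sqrt_self B hB
  have hcc : c * c = B + C := CFC.sqrt_mul_sqrt_self _ hBC0
  have hac : a ≤ c := sqrt_mono hAC
  have hbc : b ≤ c := sqrt_mono hBC
  have h1 : (a * (a - b)).trace.re ≤ (a * (c - b)).trace.re :=
    trace_mul_re_mono (CFC.sqrt_nonneg _) (sub_le_sub_right hac _)
  have h2 : ((c - b) * a).trace.re ≤ ((c - b) * c).trace.re :=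
    trace_mul_re_mono (sub_nonneg.mpr hbc) hac
  have h3 : (b * b).trace.re ≤ (b * c).trace.re := trace_mul_re_mono (CFC.sqrt_nonneg _) hbc
  rw [trace_mul_comm] at h2
  simp only [Matrix.mul_sub, Matrix.sub_mul, trace_sub, Complex.sub_re, haa, hbb, hcc, trace_add,
    Complex.add_re] at h1 h2 h3
  have h4 : C.trace.re = (P * A).trace.re - (P * B).trace.re := by
    rw [hCdef, hD, Matrix.mul_sub, trace_sub, Complex.sub_re]
  simp only [Matrix.sub_mul, Matrix.one_mul, trace_sub, Complex.sub_re]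
  have h5 : (c * b).trace.re = (b * c).trace.re := by rw [trace_mul_comm]
  linarith

/-- The Hayashi-Nagaoka inequality for a projection `T`. -/
theorem one_sub_conj_le {T R G : Matrix n n ℂ} (hT : 0 ≤ T) (hTT : T * T = T) (hR : 0 ≤ R)
    (hG : Gᴴ = G) (hGS : G * (T + R) = CFC.sqrt (T + R)) (hSG : (T + R) * G = CFC.sqrt (T + R))
    (hle : G * (T + R) * G ≤ 1) :
    1 - G * T * G ≤ (2 : ℝ) • (1 - T) + (4 : ℝ) • R := by
  set S := T + R with hS
  have hTS : T ≤ S := le_add_of_nonneg_right hR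
  have hsT : T ≤ CFC.sqrt S := by
    have h := sqrt_mono hTS
    rwa [CFC.sqrt_unique hTT hT] at h
  have h1 : 0 ≤ (G - 2)ᴴ * R * (G - 2) := by simpa using conj_mono hR (G - 2)
  have h2 : (G - 1)ᴴ * R * (G - 1) ≤ (G - 1)ᴴ * S * (G - 1) :=
    conj_mono (le_add_of_nonneg_left hT) _
  have e2 : (G - 2)ᴴ = G - 2 := by rw [conjTranspose_sub, hG]; simp
  have e1 : (G - 1)ᴴ = G - 1 := by rw [conjTranspose_sub, hG]; simp
  rw [e2] at h1
  rw [e1] at h2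
  have h3 : (G - 1) * S * (G - 1) = G * S * G - (2 : ℝ) • CFC.sqrt S + S := by
    have : (G - 1) * S * (G - 1) = G * S * G - G * S - S * G + S := by noncomm_ring
    rw [this, hGS, hSG, two_smul]; abel
  -- The gap between the two sides is `2(G-1)T(G-1) + (G-2)R(G-2) + 4(√S - T) + (1 - GSG)`, a sum of
  -- positive terms. The third is positive because the projection `T` is its own square root.
  have h4 : (2 : ℝ) • ((G - 1) * S * (G - 1)) - (2 : ℝ) • ((G - 1) * R * (G - 1)) +
      (G - 2) * R * (G - 2) + (4 : ℝ) • (CFC.sqrt S - T) + (1 - G * S * G) =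
      (2 : ℝ) • (1 - T) + (4 : ℝ) • R - (1 - G * T * G) := by
    have hT' : G * T * G = G * S * G - G * R * G := by rw [hS]; noncomm_ring
    have e3 : (G - 1) * R * (G - 1) = G * R * G - G * R - R * G + R := by noncomm_ring
    have e4 : (G - 2) * R * (G - 2)
        = G * R * G - (2 : ℝ) • (G * R) - (2 : ℝ) • (R * G) + (4 : ℝ) • R := by
      simp only [ofNat_smul_eq_nsmul]
      noncomm_ring
    rw [h3, e3, e4, hT']
    rw [show S = T + R from hS]
    module
  rw [← sub_nonneg, ← h4]
  have h5 : (0 : Matrix n n ℂ) ≤ (4 : ℝ) • (CFC.sqrt S - T) :=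
    smul_nonneg (by norm_num) (sub_nonneg.mpr hsT)
  have h6 : (0 : Matrix n n ℂ) ≤
      (2 : ℝ) • ((G - 1) * S * (G - 1)) - (2 : ℝ) • ((G - 1) * R * (G - 1)) := by
    rw [← smul_sub]
    exact smul_nonneg (by norm_num) (sub_nonneg.mpr h2)
  exact add_nonneg (add_nonneg (add_nonneg h6 h1) h5) (sub_nonneg.mpr hle)

end MatrixInequalities

/-! ### Block-diagonal operators and classical-quantum states -/

section BlockDiagonal

open Matrix

variable {X B : Type*} [Fintype X] [DecidableEq X] [Fintype B] [DecidableEq B]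

/-- The block-diagonal operator `∑ₓ |x⟩⟨x| ⊗ Mₓ`. -/
def blockDiag (M : X → Matrix B B ℂ) : Matrix (X × B) (X × B) ℂ :=
  (blockDiagonal M).submatrix (Equiv.prodComm X B) (Equiv.prodComm X B)

/-- The block `⟨x| M |x⟩`. -/
def diagBlock (M : Matrix (X × B) (X × B) ℂ) (x : X) : Matrix B B ℂ :=
  M.submatrix (fun b => (x, b)) (fun b => (x, b))

theorem blockDiag_apply (M : X → Matrix B B ℂ) (i j : X × B) :
    blockDiag M i j = if i.1 = j.1 then M i.1 i.2 j.2 else 0 := by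
  simp [blockDiag, blockDiagonal_apply]

theorem blockDiag_mul (M N : X → Matrix B B ℂ) :
    blockDiag M * blockDiag N = blockDiag fun x => M x * N x := by
  unfold blockDiag
  rw [submatrix_mul_equiv, ← blockDiagonal_mul]

theorem blockDiag_conjTranspose (M : X → Matrix B B ℂ) :
    (blockDiag M)ᴴ = blockDiag fun x => (M x)ᴴ := by
  unfold blockDiag
  rw [conjTranspose_submatrix, blockDiagonal_conjTranspose]

theorem blockDiag_one : blockDiag (fun _ : X => (1 : Matrix B B ℂ)) = 1 := by
  unfold blockDiag
  rw [show (fun _ : X => (1 : Matrix B B ℂ)) = 1 from rfl, blockDiagonal_one,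
    submatrix_one_equiv]

theorem blockDiag_sub (M N : X → Matrix B B ℂ) :
    blockDiag (fun x => M x - N x) = blockDiag M - blockDiag N := by
  ext i j
  simp only [blockDiag_apply, Matrix.sub_apply]
  split_ifs <;> simp

theorem blockDiag_nonneg {M : X → Matrix B B ℂ} (hM : ∀ x, 0 ≤ M x) : 0 ≤ blockDiag M := by
  have h : blockDiag M
      = (blockDiag fun x => CFC.sqrt (M x))ᴴ * blockDiag fun x => CFC.sqrt (M x) := by
    rw [blockDiag_conjTranspose, blockDiag_mul]
    congr 1
    funext x
    rw [sqrt_conjTranspose, CFC.sqrt_mul_sqrt_self _ (hM x)]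
  rw [h]
  exact conjTranspose_mul_self_nonneg _

theorem blockDiag_mono {M N : X → Matrix B B ℂ} (h : ∀ x, M x ≤ N x) :
    blockDiag M ≤ blockDiag N := by
  rw [← sub_nonneg, ← blockDiag_sub]
  exact blockDiag_nonneg fun x => sub_nonneg.mpr (h x)

theorem sqrt_blockDiag {M : X → Matrix B B ℂ} (hM : ∀ x, 0 ≤ M x) :
    CFC.sqrt (blockDiag M) = blockDiag fun x => CFC.sqrt (M x) := by
  refine CFC.sqrt_unique ?_ (blockDiag_nonneg fun x => CFC.sqrt_nonneg _)
  rw [blockDiag_mul]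
  congr 1
  funext x
  exact CFC.sqrt_mul_sqrt_self _ (hM x)

theorem isContraction_blockDiag {M : X → Matrix B B ℂ} (hM : ∀ x, IsContraction (M x)) :
    IsContraction (blockDiag M) := by
  unfold IsContraction
  rw [blockDiag_conjTranspose, blockDiag_mul, ← blockDiag_one]
  exact blockDiag_mono hM

theorem trace_blockDiag_mul (N : X → Matrix B B ℂ) (M : Matrix (X × B) (X × B) ℂ) :
    (blockDiag N * M).trace = ∑ x, (N x * diagBlock M x).trace := by
  simp only [trace, diag_apply, mul_apply, Fintype.sum_prod_type, blockDiag_apply, diagBlock,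
    submatrix_apply, ite_mul, zero_mul, Finset.sum_ite_irrel, Finset.sum_const_zero,
    Finset.sum_ite_eq, Finset.mem_univ, if_true]

theorem diagBlock_blockDiag (M : X → Matrix B B ℂ) (x : X) : diagBlock (blockDiag M) x = M x := by
  ext i j
  simp [diagBlock, blockDiag_apply]

theorem trace_blockDiag (N : X → Matrix B B ℂ) : (blockDiag N).trace = ∑ x, (N x).trace := by
  simpa [blockDiag_one, diagBlock_blockDiag] using
    trace_blockDiag_mul (fun _ => (1 : Matrix B B ℂ)) (blockDiag N)

theorem cqState_eq_blockDiag (p : X → ℝ) (φ : X → Matrix B B ℂ) :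
    cqState p φ = blockDiag fun x => (p x : ℂ) • φ x := by
  ext ⟨x, b⟩ ⟨x', b'⟩
  simp only [cqState, blockDiag_apply, Matrix.sum_apply, Matrix.smul_apply, kroneckerMap_apply, single_apply,
    smul_eq_mul, ite_mul, one_mul, zero_mul, mul_ite, mul_zero]
  by_cases h : x = x'
  · subst h; simp
  · rw [if_neg h]
    exact Finset.sum_eq_zero fun y _ => if_neg fun hy => h (hy.1.symm.trans hy.2)

theorem one_kronecker_eq_blockDiag (σ : Matrix B B ℂ) :
    (1 : Matrix X X ℂ) ⊗ₖ σ = blockDiag fun _ => σ := by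
  ext ⟨x, b⟩ ⟨x', b'⟩
  simp [blockDiag_apply, kroneckerMap_apply, one_apply]

theorem smul_state_nonneg {p : ℝ} (hp : 0 ≤ p) {A : Matrix B B ℂ} (hA : 0 ≤ A) :
    0 ≤ (p : ℂ) • A :=
  smul_nonneg (by exact_mod_cast hp) hA

theorem cqState_nonneg {p : X → ℝ} (hp : ∀ x, 0 ≤ p x) {φ : X → Matrix B B ℂ}
    (hφ : ∀ x, IsState (φ x)) : 0 ≤ cqState p φ := by
  rw [cqState_eq_blockDiag]
  exact blockDiag_nonneg fun x => smul_state_nonneg (hp x) (hφ x).1.nonneg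

theorem cqState_trace {p : X → ℝ} (hp_sum : ∑ x, p x = 1) {φ : X → Matrix B B ℂ}
    (hφ : ∀ x, IsState (φ x)) : (cqState p φ).trace = 1 := by
  rw [cqState_eq_blockDiag, trace_blockDiag]
  simp only [trace_smul, (hφ _).2, smul_eq_mul, mul_one]
  exact_mod_cast hp_sum

end BlockDiagonal

/-! ### Random hashing and the pretty good measurement -/

section RandomCoding

open Matrix

variable {X B C : Type*} [Fintype X] [DecidableEq X] [Fintype B] [DecidableEq B]
  [Fintype C] [DecidableEq C]

/-- Completing the pretty good measurement for the code `E` and the projections `P` to a POVM. -/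
theorem exists_decoder [Nonempty X] (E : X → C) {P : X → Matrix B B ℂ} (hP : ∀ x, 0 ≤ P x)
    (hPP : ∀ x, P x * P x = P x) :
    ∃ Λ : C → X → Matrix B B ℂ, (∀ c, IsPOVM (Λ c)) ∧ ∀ x, 1 - Λ (E x) x ≤
      (2 : ℝ) • (1 - P x) + (4 : ℝ) • ∑ x' ∈ Finset.univ.erase x,
        if E x' = E x then P x' else 0 := by
  obtain ⟨x₀⟩ := ‹Nonempty X›
  let S : C → Matrix B B ℂ := fun c => ∑ x, if E x = c then P x else 0
  have hterm : ∀ c x, 0 ≤ (if E x = c then P x else 0) := fun c x => by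
    split_ifs
    · exact hP x
    · exact le_rfl
  have hS : ∀ c, 0 ≤ S c := fun c => Finset.sum_nonneg fun x _ => hterm c x
  choose G hG hGS hSG hle using fun c => exists_invSqrt (hS c)
  have hsum : ∀ c, ∑ x, (if E x = c then G c * P x * G c else 0) = G c * S c * G c := fun c => by
    simp only [S, Finset.mul_sum, Finset.sum_mul]
    refine Finset.sum_congr rfl fun x _ => ?_
    split_ifs <;> simp
  have hGP : ∀ c x, 0 ≤ G c * P x * G c := fun c x => by
    simpa [hG] using conj_mono (hP x) (G c)
  -- The defect `1 - G c * S c * G c` is assigned to an arbitrary outcome `x₀`; enlarging an effect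
  -- only lowers its error.
  refine ⟨fun c x => (if E x = c then G c * P x * G c else 0) +
    if x = x₀ then 1 - G c * S c * G c else 0, fun c => ⟨fun x => ?_, ?_⟩, fun x => ?_⟩
  · rw [← nonneg_iff_posSemidef]
    refine add_nonneg ?_ ?_
    · split_ifs
      · exact hGP c x
      · exact le_rfl
    · split_ifs
      · exact sub_nonneg.mpr (hle c)
      · exact le_rfl
  · rw [Finset.sum_add_distrib, hsum]
    simp
  · have hSx : S (E x) = P x + ∑ x' ∈ Finset.univ.erase x, if E x' = E x then P x' else 0 := by
      simp only [S]
      rw [← Finset.add_sum_erase _ _ (Finset.mem_univ x), if_pos rfl]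
    have hc : (0 : Matrix B B ℂ) ≤ if x = x₀ then 1 - G (E x) * S (E x) * G (E x) else 0 := by
      split_ifs
      · exact sub_nonneg.mpr (hle _)
      · exact le_rfl
    refine le_trans (sub_le_sub_left (le_add_of_nonneg_right hc) 1) ?_
    rw [if_pos rfl]
    refine one_sub_conj_le (hP x) (hPP x) (Finset.sum_nonneg fun x' _ => hterm _ x') (hG _) ?_ ?_ ?_
    · rw [← hSx]; exact hGS _
    · rw [← hSx]; exact hSG _
    · rw [← hSx]; exact hle _

/-- Uniformly random functions are universal hash functions. -/
theorem card_filter_apply_eq_mul_card {x x' : X} (h : x' ≠ x) :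
    (Finset.univ.filter fun E : X → C => E x' = E x).card * Fintype.card C
      = Fintype.card (X → C) := by
  rw [← Finset.card_univ (α := C), ← Finset.card_product, ← Finset.card_univ (α := X → C)]
  -- A collision `E x' = E x` makes the value at `x` redundant: overwriting it by a free `c` gives
  -- an arbitrary function, and copying the value at `x'` back undoes this.
  refine Finset.card_nbij' (fun q => Function.update q.1 x q.2)
    (fun E => (Function.update E x (E x'), E x)) ?_ ?_ ?_ ?_
  · simp
  · intro E _
    simp [Function.update_of_ne h]
  · rintro ⟨E, c⟩ hE
    have hE' : E x' = E x := by simpa using hE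
    simp [Function.update_of_ne h, hE']
  · intro E _
    simp

theorem sum_ite_apply_eq [Nonempty C] {x x' : X} (h : x' ≠ x) (a : ℝ) :
    ∑ E : X → C, (if E x' = E x then a else 0)
      = Fintype.card (X → C) * (a / Fintype.card C) := by
  have hc : (Fintype.card C : ℝ) ≠ 0 := by exact_mod_cast Fintype.card_ne_zero
  rw [← Finset.sum_filter, Finset.sum_const, nsmul_eq_mul,
    ← card_filter_apply_eq_mul_card (C := C) h]
  push_cast
  field_simp

/-- One-shot coding by random hashing and pretty good measurements, for unnormalized ensembles. -/
theorem exists_code [Nonempty X] [Nonempty C] {ρ : X → Matrix B B ℂ} (hρ : ∀ x, 0 ≤ ρ x) :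
    ∃ (E : X → C) (Λ : C → X → Matrix B B ℂ), (∀ c, IsPOVM (Λ c)) ∧
      ∑ x, ((1 - Λ (E x) x) * ρ x).trace.re ≤
        2 * ∑ x, (CFC.sqrt (ρ x) * CFC.sqrt ((2 / Fintype.card C : ℝ) • ∑ y, ρ y)).trace.re := by
  have hB : 0 ≤ ∑ y, ρ y := Finset.sum_nonneg fun y _ => hρ y
  have hcard : (0 : ℝ) ≤ 2 / Fintype.card C := by positivity
  -- The threshold `2/|C|` is the ratio `4/2` of the Hayashi-Nagaoka weights times the collision
  -- probability `1/|C|`, so the two error terms combine into one Chernoff expression.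
  choose P hP hPP hPle using fun x => exists_projection_trace_le (hρ x) (smul_nonneg hcard hB)
  choose Λ hΛ hΛle using fun E : X → C => exists_decoder E hP hPP
  have herr : ∀ E : X → C, ∑ x, ((1 - Λ E (E x) x) * ρ x).trace.re ≤
      ∑ x, (2 * ((1 - P x) * ρ x).trace.re +
        4 * ∑ x' ∈ Finset.univ.erase x, if E x' = E x then (P x' * ρ x).trace.re else 0) := by
    intro E
    refine Finset.sum_le_sum fun x _ => ?_
    have h := trace_mul_re_mono (hρ x) (hΛle E x)
    rw [trace_mul_comm] at h
    refine h.trans (le_of_eq ?_)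
    rw [Matrix.mul_add, Matrix.mul_smul, Matrix.mul_smul, trace_add, trace_smul, trace_smul,
      Complex.add_re, Complex.smul_re, Complex.smul_re, smul_eq_mul, smul_eq_mul,
      trace_mul_comm (ρ x), Finset.mul_sum, trace_sum, Complex.re_sum]
    congr 2
    refine Finset.sum_congr rfl fun x' _ => ?_
    split_ifs
    · rw [trace_mul_comm]
    · simp
  have hcross : ∀ x x', 0 ≤ (P x' * ρ x).trace.re := fun x x' => trace_mul_re_nonneg (hP x') (hρ x)
  have havg : ∑ E : X → C, ∑ x, ((1 - Λ E (E x) x) * ρ x).trace.re ≤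
      ∑ _E : X → C,
        2 * ∑ x, (CFC.sqrt (ρ x) * CFC.sqrt ((2 / Fintype.card C : ℝ) • ∑ y, ρ y)).trace.re := by
    refine (Finset.sum_le_sum fun E _ => herr E).trans ?_
    rw [Finset.sum_comm]
    simp only [Finset.sum_add_distrib, ← Finset.mul_sum]
    simp only [Finset.sum_const, Finset.card_univ, nsmul_eq_mul, ← Finset.mul_sum]
    -- The term `x' = x` is added back for free, turning the sum of competitors into the full
    -- marginal.
    have h1 : ∀ x, ∑ E : X → C, ∑ x' ∈ Finset.univ.erase x,
        (if E x' = E x then (P x' * ρ x).trace.re else 0) ≤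
        Fintype.card (X → C) * ((∑ x', (P x' * ρ x).trace.re) / Fintype.card C) := by
      intro x
      rw [Finset.sum_comm, Finset.sum_div, Finset.mul_sum]
      refine (Finset.sum_le_sum fun x' hx' =>
        (sum_ite_apply_eq (Finset.ne_of_mem_erase hx') _).le).trans ?_
      refine Finset.sum_le_sum_of_subset_of_nonneg (Finset.erase_subset _ _) fun x' _ _ => ?_
      have := hcross x x'
      positivity
    have h2 : ∑ x, (∑ x', (P x' * ρ x).trace.re) / Fintype.card C
        = ∑ x, (P x * ((2 / Fintype.card C : ℝ) • ∑ y, ρ y)).trace.re / 2 := by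
      simp only [Finset.sum_div]
      rw [Finset.sum_comm]
      refine Finset.sum_congr rfl fun x _ => ?_
      rw [Matrix.mul_smul, trace_smul, Complex.smul_re, Finset.mul_sum, trace_sum, Complex.re_sum,
        ← Finset.sum_div, smul_eq_mul]
      ring
    have h3 := Finset.sum_le_sum fun x (_ : x ∈ Finset.univ) => hPle x
    have h4 := Finset.sum_le_sum fun x (_ : x ∈ Finset.univ) => h1 x
    rw [← Finset.mul_sum, h2, ← Finset.sum_div] at h4
    rw [Finset.sum_add_distrib] at h3
    have h5 := mul_le_mul_of_nonneg_left h3 (Nat.cast_nonneg (α := ℝ) (Fintype.card (X → C)))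
    linarith
  obtain ⟨E, -, hE⟩ := Finset.exists_le_of_sum_le Finset.univ_nonempty havg
  exact ⟨E, Λ E, hΛ E, hE⟩

end RandomCoding

/-! ### Fidelity and two-outcome tests -/

section FidelityBounds

open Matrix

variable {n : Type*} [Fintype n] [DecidableEq n]

theorem trace_contraction_conj_re_le {K ρ : Matrix n n ℂ} (hK : IsContraction K) (hρ : 0 ≤ ρ) :
    (K * ρ * Kᴴ).trace.re ≤ ρ.trace.re := by
  rw [trace_mul_comm, ← Matrix.mul_assoc, trace_mul_comm]
  simpa using trace_mul_re_mono hρ hK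

theorem mul_self_le_self {L : Matrix n n ℂ} (h0 : 0 ≤ L) (h1 : L ≤ 1) : L * L ≤ L := by
  have h := conj_mono h1 (CFC.sqrt L)
  have e := CFC.sqrt_mul_sqrt_self L h0
  rw [sqrt_conjTranspose, Matrix.mul_one, e] at h
  refine le_trans (le_of_eq ?_) h
  calc L * L = (CFC.sqrt L * CFC.sqrt L) * (CFC.sqrt L * CFC.sqrt L) := by rw [e]
    _ = CFC.sqrt L * (CFC.sqrt L * CFC.sqrt L) * CFC.sqrt L := by simp only [Matrix.mul_assoc]
    _ = CFC.sqrt L * L * CFC.sqrt L := by rw [e]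

theorem sqrt_smul {c : ℝ} (hc : 0 ≤ c) {A : Matrix n n ℂ} (hA : 0 ≤ A) :
    CFC.sqrt (c • A) = √c • CFC.sqrt A := by
  refine CFC.sqrt_unique ?_ (smul_nonneg (Real.sqrt_nonneg c) (CFC.sqrt_nonneg A))
  rw [smul_mul_smul_comm, Real.mul_self_sqrt hc, CFC.sqrt_mul_sqrt_self A hA]

/-- Cauchy-Schwarz for the semi-inner product `Tr(uᴴ T v)`. -/
theorem trace_mul_mul_re_le {T : Matrix n n ℂ} (hT : 0 ≤ T) (s D : Matrix n n ℂ) :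
    (sᴴ * T * D).trace.re ≤ √((T * (s * sᴴ)).trace.re) * √((T * (D * Dᴴ)).trace.re) := by
  have e := CFC.sqrt_mul_sqrt_self T hT
  have h : ∀ u v : Matrix n n ℂ, (CFC.sqrt T * u)ᴴ * (CFC.sqrt T * v) = uᴴ * T * v := fun u v => by
    rw [conjTranspose_mul, sqrt_conjTranspose]
    conv_rhs => rw [← e]
    noncomm_ring
  have h' : ∀ u : Matrix n n ℂ, (T * (u * uᴴ)).trace = (uᴴ * T * u).trace := fun u => by
    rw [← Matrix.mul_assoc, trace_mul_comm, Matrix.mul_assoc]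
  rw [h', h', ← h, ← h, ← h]
  exact trace_conjTranspose_mul_re_le _ _

/-- With `a = cos² α` and `b = cos² β`, enlarging `d` to `1` gives `F ≤ cos(α - β)`, while `a - b =
sin(β - α) sin(β + α)`. -/
theorem sub_le_sqrt_one_sub_sq {F a b d : ℝ} (hF : 0 ≤ F) (ha : 0 ≤ a) (ha1 : a ≤ 1) (hb : 0 ≤ b)
    (hbd : b ≤ d) (hd : d ≤ 1) (h : F ≤ √a * √b + √(1 - a) * √(d - b)) :
    a - b ≤ √(1 - F ^ 2) := by
  have h' : F ≤ √a * √b + √(1 - a) * √(1 - b) := by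
    refine h.trans ?_
    gcongr
  refine Real.le_sqrt_of_sq_le ?_
  have hx := Real.sq_sqrt ha
  have hy := Real.sq_sqrt (sub_nonneg.mpr ha1)
  have hu := Real.sq_sqrt hb
  have hv := Real.sq_sqrt (sub_nonneg.mpr (hbd.trans hd))
  set x := √a
  set y := √(1 - a)
  set u := √b
  set v := √(1 - b)
  have hxy : x ^ 2 + y ^ 2 = 1 := by linarith
  have huv : u ^ 2 + v ^ 2 = 1 := by linarith
  have hF2 : F ^ 2 ≤ (x * u + y * v) ^ 2 := pow_le_pow_left₀ hF h' 2
  have e1 : (x * u + y * v) ^ 2 + (x * v - y * u) ^ 2 = 1 := by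
    calc _ = (x ^ 2 + y ^ 2) * (u ^ 2 + v ^ 2) := by ring
      _ = 1 := by rw [hxy, huv, mul_one]
  have e2 : (x * v + y * u) ^ 2 + (x * u - y * v) ^ 2 = 1 := by
    calc _ = (x ^ 2 + y ^ 2) * (u ^ 2 + v ^ 2) := by ring
      _ = 1 := by rw [hxy, huv, mul_one]
  have e3 : a - b = (x * v - y * u) * (x * v + y * u) := by
    calc a - b = x ^ 2 * (u ^ 2 + v ^ 2) - u ^ 2 * (x ^ 2 + y ^ 2) := by
          rw [hxy, huv, hx, hu]; ring
      _ = _ := by ring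
  have e4 : (a - b) ^ 2 ≤ (x * v - y * u) ^ 2 := by
    rw [e3, mul_pow]
    exact mul_le_of_le_one_right (sq_nonneg _) (by nlinarith [sq_nonneg (x * u - y * v)])
  linarith

end FidelityBounds

/-! ### Making the smoothed operator classical on `X` -/

section Smoothing

open Matrix

variable {X B : Type*} [Fintype X] [DecidableEq X] [Fintype B] [DecidableEq B]

/-- An operator `ρ` close to a block-diagonal state `blockDiag q` can be replaced by a
block-diagonal one without increasing its conditional max-entropy. -/
theorem exists_blockDiag_near {q : X → Matrix B B ℂ} (hq : ∀ x, 0 ≤ q x)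
    (hq1 : ∑ x, (q x).trace.re = 1) {ρ : Matrix (X × B) (X × B) ℂ} (hρ : IsSubState ρ) :
    ∃ ω : X → Matrix B B ℂ, (∀ x, 0 ≤ ω x) ∧ ∑ x, (ω x).trace.re ≤ 1 ∧
      fidelity (blockDiag q) ρ ^ 2 ≤ ∑ x, (ω x).trace.re ∧
      (∀ T : X → Matrix B B ℂ, (∀ x, 0 ≤ T x) → (∀ x, T x ≤ 1) →
        ∑ x, (T x * q x).trace.re - ∑ x, (T x * ω x).trace.re ≤
          √(1 - fidelity (blockDiag q) ρ ^ 2)) ∧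
      ∀ σ : Matrix B B ℂ, 0 ≤ σ → ∑ x, (CFC.sqrt (ω x) * CFC.sqrt σ).trace.re ≤
        fidelity ρ ((1 : Matrix X X ℂ) ⊗ₖ σ) := by
  have hρ0 : 0 ≤ ρ := hρ.1.nonneg
  obtain ⟨K, hK, hKF⟩ := exists_contraction_traceNorm (CFC.sqrt (blockDiag q) * CFC.sqrt ρ)
  have hF0 : 0 ≤ fidelity (blockDiag q) ρ := fidelity_nonneg _ _
  change _ = fidelity (blockDiag q) ρ at hKF
  set F := fidelity (blockDiag q) ρ
  set M := CFC.sqrt ρ * K with hM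
  set N := diagBlock M with hN
  set s : X → Matrix B B ℂ := fun x => CFC.sqrt (q x) with hs
  have hss : ∀ x, s x * (s x)ᴴ = q x := fun x => by
    rw [hs]; dsimp only; rw [sqrt_conjTranspose, CFC.sqrt_mul_sqrt_self _ (hq x)]
  have hst : (blockDiag s)ᴴ = blockDiag s := by
    rw [blockDiag_conjTranspose]; congr 1; funext x; exact sqrt_conjTranspose _
  have hFN : (blockDiag s * blockDiag N).trace.re = F := by
    rw [← hKF, sqrt_blockDiag hq, trace_mul_comm K, Matrix.mul_assoc, ← hM, trace_blockDiag_mul,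
      trace_blockDiag_mul]
    simp only [diagBlock_blockDiag, hN, hs]
  have hsq : blockDiag s * (blockDiag s)ᴴ = blockDiag q := by
    rw [blockDiag_conjTranspose, blockDiag_mul]; simp only [hss]
  have hNN : blockDiag N * (blockDiag N)ᴴ = blockDiag fun x => N x * (N x)ᴴ := by
    rw [blockDiag_conjTranspose, blockDiag_mul]
  have htest : ∀ T : X → Matrix B B ℂ, (∀ x, 0 ≤ T x) →
      (blockDiag s * blockDiag T * blockDiag N).trace.re ≤
        √(∑ x, (T x * q x).trace.re) * √(∑ x, (T x * (N x * (N x)ᴴ)).trace.re) := by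
    intro T hT
    have h := trace_mul_mul_re_le (blockDiag_nonneg hT) (blockDiag s) (blockDiag N)
    rw [hNN, hsq, hst, blockDiag_mul T, blockDiag_mul T, trace_blockDiag (fun x => T x * q x),
      trace_blockDiag (fun x => T x * (N x * (N x)ᴴ)), Complex.re_sum, Complex.re_sum] at h
    exact h
  have hω : ∀ x, 0 ≤ N x * (N x)ᴴ := fun x => self_mul_conjTranspose_nonneg _
  have hd0 : 0 ≤ ∑ x, (N x * (N x)ᴴ).trace.re :=
    Finset.sum_nonneg fun x _ => trace_re_nonneg (hω x)
  -- Taking diagonal blocks is an orthogonal projection for the Hilbert-Schmidt product, so the norm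
  -- of `N` is at most that of `M`, whose square is at most `Tr ρ`.
  have hd1 : ∑ x, (N x * (N x)ᴴ).trace.re ≤ 1 := by
    have h := trace_conjTranspose_mul_re_sq_le (blockDiag N) M
    rw [show ((blockDiag N)ᴴ * M).trace.re = ∑ x, (N x * (N x)ᴴ).trace.re by
        rw [blockDiag_conjTranspose, trace_blockDiag_mul, Complex.re_sum]
        exact Finset.sum_congr rfl fun x _ => by rw [trace_mul_comm],
      trace_mul_comm (blockDiag N)ᴴ, hNN, trace_blockDiag, Complex.re_sum] at h
    have hMM : (Mᴴ * M).trace.re ≤ 1 := by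
      refine le_trans ?_ hρ.2
      have h2 := trace_contraction_conj_re_le hK.conjTranspose hρ0
      refine le_trans (le_of_eq ?_) h2
      rw [hM, conjTranspose_mul, sqrt_conjTranspose, conjTranspose_conjTranspose]
      conv_rhs => rw [← CFC.sqrt_mul_sqrt_self ρ hρ0]
      simp only [Matrix.mul_assoc]
    nlinarith
  refine ⟨fun x => N x * (N x)ᴴ, hω, hd1, ?_, ?_, ?_⟩
  · have h := htest (fun _ => 1) fun _ => zero_le_one
    rw [blockDiag_one, Matrix.mul_one, hFN] at h
    simp only [hq1, Real.sqrt_one, one_mul] at h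
    calc F ^ 2 ≤ √(∑ x, (N x * (N x)ᴴ).trace.re) ^ 2 := pow_le_pow_left₀ hF0 h 2
      _ = _ := Real.sq_sqrt hd0
  · intro T hT hT1
    have hT1' : ∀ x, 0 ≤ 1 - T x := fun x => sub_nonneg.mpr (hT1 x)
    have hsub : ∀ A : X → Matrix B B ℂ, ∑ x, ((1 - T x) * A x).trace.re
        = ∑ x, (A x).trace.re - ∑ x, (T x * A x).trace.re := fun A => by
      simp [Matrix.sub_mul, trace_sub]
    have h1 := htest T hT
    have h2 := htest (fun x => 1 - T x) hT1'
    rw [hsub, hsub, hq1, blockDiag_sub, blockDiag_one, Matrix.mul_sub, Matrix.mul_one,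
      Matrix.sub_mul, trace_sub, Complex.sub_re, hFN] at h2
    have hq' := hsub q
    have hω' := hsub fun x => N x * (N x)ᴴ
    refine sub_le_sqrt_one_sub_sq hF0
      (Finset.sum_nonneg fun x _ => trace_mul_re_nonneg (hT x) (hq x)) ?_
      (Finset.sum_nonneg fun x _ => trace_mul_re_nonneg (hT x) (hω x)) ?_ hd1
      (by linarith)
    · have := Finset.sum_nonneg fun x (_ : x ∈ Finset.univ) =>
        trace_mul_re_nonneg (hT1' x) (hq x)
      linarith
    · have := Finset.sum_nonneg fun x (_ : x ∈ Finset.univ) =>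
        trace_mul_re_nonneg (hT1' x) (hω x)
      linarith
  · intro σ hσ
    -- Since `√(ω x) = N x * V x`, the overlap with `√σ` is a value of the variational formula for
    -- the fidelity of `ρ` at the contraction `K * blockDiag V`.
    choose V hV hVN _ using fun x => exists_polar (N x)ᴴ
    have hsqrt : ∀ x, CFC.sqrt (N x * (N x)ᴴ) = N x * V x := fun x => by
      have h := congrArg Matrix.conjTranspose (hVN x)
      rw [conjTranspose_mul, conjTranspose_conjTranspose, conjTranspose_conjTranspose,
        sqrt_conjTranspose] at h
      exact h.symm
    have h := trace_sqrt_mul_sqrt_mul_re_le_fidelity (hK.mul (isContraction_blockDiag hV)) ρ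
      ((1 : Matrix X X ℂ) ⊗ₖ σ)
    refine le_trans (le_of_eq ?_) h
    rw [one_kronecker_eq_blockDiag, sqrt_blockDiag fun _ => hσ]
    have e : (blockDiag (fun _ : X => CFC.sqrt σ) * CFC.sqrt ρ * (K * blockDiag V)).trace
        = (blockDiag (fun x => V x * CFC.sqrt σ) * M).trace := by
      rw [← Matrix.mul_assoc, trace_mul_comm, ← blockDiag_mul, hM]
      simp only [Matrix.mul_assoc]
    rw [e, trace_blockDiag_mul, Complex.re_sum]
    refine Finset.sum_congr rfl fun x _ => ?_
    dsimp only
    rw [hsqrt, ← hN, Matrix.mul_assoc, trace_mul_comm]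

end Smoothing

/-! ### Protocols from nearby states, and nearby states from protocols -/

section Protocols

open Matrix

variable {X B : Type*} [Fintype X] [DecidableEq X] [Fintype B] [DecidableEq B]

theorem errorProb_eq_sum {C : Type*} {p : X → ℝ} {φ : X → Matrix B B ℂ}
    (hp_sum : ∑ x, p x = 1) (hφ : ∀ x, IsState (φ x)) (E : X → C)
    (Λ : C → X → Matrix B B ℂ) :
    errorProb p φ E Λ = ∑ x, ((1 - Λ (E x) x) * ((p x : ℂ) • φ x)).trace.re := by
  unfold errorProb
  rw [← hp_sum, ← Finset.sum_sub_distrib]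
  refine Finset.sum_congr rfl fun x _ => ?_
  rw [Matrix.mul_smul, trace_smul, smul_eq_mul, Complex.re_ofReal_mul, Matrix.sub_mul, trace_sub,
    Matrix.one_mul, (hφ x).2, Complex.sub_re, Complex.one_re]
  ring

theorem IsPOVM.le_one {Λ : X → Matrix B B ℂ} (h : IsPOVM Λ) (x : X) : Λ x ≤ 1 := by
  rw [← h.2]
  exact Finset.single_le_sum (fun y _ => (h.1 y).nonneg) (Finset.mem_univ x)

theorem sum_trace_smul_state {p : X → ℝ} {φ : X → Matrix B B ℂ} (hp_sum : ∑ x, p x = 1)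
    (hφ : ∀ x, IsState (φ x)) : ∑ x, ((p x : ℂ) • φ x).trace.re = 1 := by
  rw [← hp_sum]
  refine Finset.sum_congr rfl fun x _ => ?_
  rw [trace_smul, (hφ x).2]
  simp

/-- `σ` is the normalized marginal of the ensemble from `exists_blockDiag_near`. The lower bound on
the fidelity keeps the entropy finite from below and later ensures a nonnegative bit count. -/
theorem exists_state_and_protocol {p : X → ℝ} {φ : X → Matrix B B ℂ} (hp : ∀ x, 0 ≤ p x)
    (hp_sum : ∑ x, p x = 1) (hφ : ∀ x, IsState (φ x)) {ε₁ : ℝ} (h0 : 0 ≤ ε₁) (h1 : ε₁ < 1)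
    {ρ : Matrix (X × B) (X × B) ℂ} (hρ : ρ ∈ smoothBall ε₁ (cqState p φ)) :
    ∃ σ : Matrix B B ℂ, IsState σ ∧
      √(1 - ε₁ ^ 2) ≤ fidelity ρ ((1 : Matrix X X ℂ) ⊗ₖ σ) ∧
      ∀ m : ℕ, HasGoodProtocol p φ
        (ε₁ + 2 * √(2 / 2 ^ m) * fidelity ρ ((1 : Matrix X X ℂ) ⊗ₖ σ)) m := by
  have hX : Nonempty X := by
    by_contra hX
    rw [not_nonempty_iff] at hX
    simp at hp_sum
  have hq : ∀ x, 0 ≤ (p x : ℂ) • φ x := fun x => smul_state_nonneg (hp x) (hφ x).1.nonneg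
  obtain ⟨ω, hω, hω1, hFω, htest, hfid⟩ :=
    exists_blockDiag_near hq (sum_trace_smul_state hp_sum hφ) hρ.1
  have hP := hρ.2
  unfold purifDist at hP
  rw [cqState_eq_blockDiag] at hP
  have hF := (Real.sqrt_le_left h0).mp hP
  set F := fidelity (blockDiag fun x => (p x : ℂ) • φ x) ρ
  set t := ∑ x, (ω x).trace.re with ht
  have hε : 0 < 1 - ε₁ ^ 2 := by nlinarith
  have ht1 : 1 - ε₁ ^ 2 ≤ t := by linarith
  have ht0 : 0 < t := hε.trans_le ht1
  set ωB := ∑ y, ω y with hωB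
  have hωB0 : 0 ≤ ωB := Finset.sum_nonneg fun y _ => hω y
  have htr : ωB.trace = (t : ℂ) := by
    have h := (nonneg_iff_posSemidef.mp hωB0).trace_nonneg
    refine Complex.ext ?_ ?_
    · rw [Complex.ofReal_re, ht, hωB, trace_sum, Complex.re_sum]
    · rw [Complex.ofReal_im]
      exact (Complex.le_def.mp h).2.symm
  set σ : Matrix B B ℂ := t⁻¹ • ωB with hσ
  have hσ0 : 0 ≤ σ := smul_nonneg (inv_nonneg.mpr ht0.le) hωB0
  have hωσ : ωB = t • σ := by rw [hσ, smul_smul, mul_inv_cancel₀ ht0.ne', one_smul]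
  have hf := hfid σ hσ0
  have hsum0 : 0 ≤ ∑ x, (CFC.sqrt (ω x) * CFC.sqrt σ).trace.re :=
    Finset.sum_nonneg fun x _ => trace_mul_re_nonneg (CFC.sqrt_nonneg _) (CFC.sqrt_nonneg _)
  refine ⟨σ, ⟨nonneg_iff_posSemidef.mp hσ0, ?_⟩, le_trans ?_ hf, fun m => ?_⟩
  · rw [hσ, trace_smul, htr, Complex.real_smul, ← Complex.ofReal_mul, inv_mul_cancel₀ ht0.ne',
      Complex.ofReal_one]
  -- From `ω x ≤ ω_B = t σ` and operator monotonicity of the square root, `Tr(ω x) ≤ √t Tr(√(ω x)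
  -- √σ)`.
  · have h2 : t ≤ √t * ∑ x, (CFC.sqrt (ω x) * CFC.sqrt σ).trace.re := by
      rw [ht, Finset.mul_sum]
      refine Finset.sum_le_sum fun x _ => ?_
      have h3 : CFC.sqrt (ω x) ≤ CFC.sqrt ωB :=
        sqrt_mono (Finset.single_le_sum (fun y _ => hω y) (Finset.mem_univ x))
      have h4 := trace_mul_re_mono (CFC.sqrt_nonneg (ω x)) h3
      rw [CFC.sqrt_mul_sqrt_self _ (hω x), hωσ, sqrt_smul ht0.le hσ0, Matrix.mul_smul, trace_smul,
        Complex.smul_re, smul_eq_mul] at h4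
      exact h4
    have hst : 0 < √t := Real.sqrt_pos.mpr ht0
    have h3 : √t ≤ ∑ x, (CFC.sqrt (ω x) * CFC.sqrt σ).trace.re := by
      refine le_of_mul_le_mul_left ?_ hst
      rwa [Real.mul_self_sqrt ht0.le]
    exact (Real.sqrt_le_sqrt ht1).trans h3
  · obtain ⟨E, Λ, hΛ, hE⟩ := exists_code (C := Fin m → Bool) hω
    refine ⟨E, Λ, hΛ, ?_⟩
    rw [errorProb_eq_sum hp_sum hφ]
    -- The error effects serve as the test that transfers the error from `ω` to `ψ`, at cost `ε₁`.
    have h5 := htest (fun x => 1 - Λ (E x) x) (fun x => sub_nonneg.mpr ((hΛ _).le_one x))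
      fun x => sub_le_self _ ((hΛ _).1 x).nonneg
    have hcard : (Fintype.card (Fin m → Bool) : ℝ) = 2 ^ m := by simp
    have h6 : ∑ x, (CFC.sqrt (ω x) * CFC.sqrt ((2 / Fintype.card (Fin m → Bool) : ℝ) • ωB)).trace.re
        ≤ √(2 / 2 ^ m) * fidelity ρ ((1 : Matrix X X ℂ) ⊗ₖ σ) := by
      rw [hcard, hωσ, smul_smul, sqrt_smul (by positivity) hσ0]
      simp only [Matrix.mul_smul, trace_smul, Complex.smul_re, smul_eq_mul]
      rw [← Finset.mul_sum]
      refine mul_le_mul (Real.sqrt_le_sqrt ?_) hf hsum0 (Real.sqrt_nonneg _)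
      exact mul_le_of_le_one_right (by positivity) hω1
    linarith

/-- Take `L ψ L`. A polar decomposition of `√ψ L` shows that its fidelity with `ψ` is at least `Tr(L
ψ)`, the success probability. Cauchy-Schwarz reduces the upper bound to `Tr((1 ⊗ σ) L²) ≤ ∑ₓ Tr(σ Λ
(E x) x)`, and summing over all `c` instead of `c = E x` gives at most `|C|`. -/
theorem exists_near_fidelity_le {C : Type*} [Fintype C] {p : X → ℝ}
    {φ : X → Matrix B B ℂ} (hp : ∀ x, 0 ≤ p x) (hp_sum : ∑ x, p x = 1) (hφ : ∀ x, IsState (φ x))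
    {E : X → C} {Λ : C → X → Matrix B B ℂ} (hΛ : ∀ c, IsPOVM (Λ c)) :
    ∃ ρ : Matrix (X × B) (X × B) ℂ, IsSubState ρ ∧
      1 - errorProb p φ E Λ ≤ fidelity (cqState p φ) ρ ∧
      ∀ σ : Matrix B B ℂ, IsState σ →
        fidelity ρ ((1 : Matrix X X ℂ) ⊗ₖ σ) ≤ √(Fintype.card C) := by
  have hψ0 := cqState_nonneg hp hφ
  have hψ1 := cqState_trace hp_sum hφ
  have hψe := cqState_eq_blockDiag p φ
  set ψ := cqState p φ
  set L : Matrix (X × B) (X × B) ℂ := blockDiag fun x => Λ (E x) x with hL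
  have hL0 : 0 ≤ L := blockDiag_nonneg fun x => ((hΛ _).1 x).nonneg
  have hL1 : L ≤ 1 := by
    rw [← blockDiag_one]
    exact blockDiag_mono fun x => (hΛ _).le_one x
  have hLt : Lᴴ = L := hL0.isSelfAdjoint
  have hLL := mul_self_le_self hL0 hL1
  set s := CFC.sqrt ψ with hs
  have hst : sᴴ = s := sqrt_conjTranspose ψ
  have hss : s * s = ψ := CFC.sqrt_mul_sqrt_self ψ hψ0
  have hρ : (s * L)ᴴ * (s * L) = L * ψ * L := by
    rw [conjTranspose_mul, hLt, hst, ← hss]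
    simp only [Matrix.mul_assoc]
  obtain ⟨W, hW, hWs, hsW⟩ := exists_polar (s * L)
  rw [hρ] at hWs hsW
  have hρ0 : 0 ≤ L * ψ * L := hρ ▸ conjTranspose_mul_self_nonneg (s * L)
  refine ⟨L * ψ * L, ⟨nonneg_iff_posSemidef.mp hρ0, ?_⟩, ?_, fun σ hσ => ?_⟩
  · rw [trace_mul_comm, ← Matrix.mul_assoc, trace_mul_comm]
    have h := trace_mul_re_mono hψ0 (hLL.trans hL1)
    rwa [Matrix.mul_one, hψ1] at h
  · have h := trace_sqrt_mul_sqrt_mul_re_le_fidelity hW ψ (L * ψ * L)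
    refine le_trans (le_of_eq ?_) h
    rw [trace_mul_comm, ← Matrix.mul_assoc, ← hsW, trace_mul_comm, ← hs, ← Matrix.mul_assoc, hss,
      trace_mul_comm, hψe, hL, trace_blockDiag_mul, Complex.re_sum]
    unfold errorProb
    rw [sub_sub_cancel]
    refine Finset.sum_congr rfl fun x _ => ?_
    rw [diagBlock_blockDiag, Matrix.mul_smul, trace_smul, smul_eq_mul, Complex.re_ofReal_mul]
  · set τ := (1 : Matrix X X ℂ) ⊗ₖ σ with hτ
    have hσ0 : 0 ≤ σ := hσ.1.nonneg
    have hτ0 : 0 ≤ τ := by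
      rw [hτ, one_kronecker_eq_blockDiag]
      exact blockDiag_nonneg fun _ => hσ0
    obtain ⟨K, hK, hKF⟩ := exists_contraction_traceNorm (CFC.sqrt (L * ψ * L) * CFC.sqrt τ)
    change _ = fidelity (L * ψ * L) τ at hKF
    have h1 : (K * (CFC.sqrt (L * ψ * L) * CFC.sqrt τ)).trace
        = ((s * (K * Wᴴ)ᴴ)ᴴ * (L * CFC.sqrt τ)).trace := by
      rw [← hWs, conjTranspose_mul, conjTranspose_conjTranspose, hst]
      simp only [Matrix.mul_assoc]
    have h2 : ((s * (K * Wᴴ)ᴴ)ᴴ * (s * (K * Wᴴ)ᴴ)).trace.re ≤ 1 := by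
      have h := trace_contraction_conj_re_le (hK.mul hW.conjTranspose) hψ0
      rw [hψ1, Complex.one_re] at h
      refine le_trans (le_of_eq ?_) h
      rw [conjTranspose_mul s, conjTranspose_conjTranspose, hst, ← hss]
      simp only [Matrix.mul_assoc]
    have h3 : ((L * CFC.sqrt τ)ᴴ * (L * CFC.sqrt τ)).trace.re ≤ Fintype.card C := by
      have e : ((L * CFC.sqrt τ)ᴴ * (L * CFC.sqrt τ)).trace = (τ * (L * L)).trace := by
        rw [trace_mul_sqrt_conj hτ0, conjTranspose_mul, hLt]
        simp only [Matrix.mul_assoc]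
      rw [e]
      refine (trace_mul_re_mono hτ0 hLL).trans ?_
      rw [hτ, one_kronecker_eq_blockDiag, hL, blockDiag_mul, trace_blockDiag, Complex.re_sum]
      calc ∑ x, (σ * Λ (E x) x).trace.re ≤ ∑ x, ∑ c, (σ * Λ c x).trace.re :=
            Finset.sum_le_sum fun x _ => Finset.single_le_sum
              (f := fun c => (σ * Λ c x).trace.re)
              (fun c _ => trace_mul_re_nonneg hσ0 ((hΛ c).1 x).nonneg) (Finset.mem_univ (E x))
        _ = ∑ c : C, (σ * ∑ x, Λ c x).trace.re := by
            rw [Finset.sum_comm]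
            simp only [Finset.mul_sum, trace_sum, Complex.re_sum]
        _ = Fintype.card C := by
            simp [(hΛ _).2, hσ.2]
    rw [← hKF, h1]
    refine (trace_conjTranspose_mul_re_le _ _).trans ?_
    calc _ ≤ √1 * √(Fintype.card C : ℝ) := by gcongr
      _ = _ := by simp

end Protocols

/-! ### Extended-real logarithm -/

section Logarithm

theorem log2_mono {x y : ℝ≥0∞} (h : x ≤ y) : log2 x ≤ log2 y := by
  unfold log2
  refine EReal.div_le_div_right_of_nonneg ?_ (ENNReal.log_monotone h)
  exact_mod_cast Real.log_nonneg one_le_two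

theorem two_mul_log2_mono {x y : ℝ≥0∞} (h : x ≤ y) : 2 * log2 x ≤ 2 * log2 y :=
  mul_le_mul_of_nonneg_left (log2_mono h) (by norm_num)

theorem two_mul_log2_ofReal {x : ℝ} (hx : 0 < x) :
    2 * log2 (ENNReal.ofReal x) = ((2 * Real.logb 2 x : ℝ) : EReal) := by
  unfold log2
  rw [ENNReal.log_ofReal_of_pos hx, ← EReal.coe_div, EReal.coe_mul]
  rfl

theorem log2_top : log2 ⊤ = ⊤ := by
  unfold log2
  rw [ENNReal.log_top]
  exact EReal.top_div_of_pos_ne_top (by exact_mod_cast Real.log_pos one_lt_two) (EReal.coe_ne_top _)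

end Logarithm

/-! ### Entropic bounds on the code length -/

section Main

open Matrix

variable {X B : Type*} [Fintype X] [DecidableEq X] [Fintype B] [DecidableEq B]

theorem le_hmax (ρ : Matrix (X × B) (X × B) ℂ) {σ : Matrix B B ℂ} (hσ : IsState σ) :
    2 * log2 (ENNReal.ofReal (fidelity ρ ((1 : Matrix X X ℂ) ⊗ₖ σ))) ≤ hmax ρ :=
  le_iSup₂ (f := fun (σ : Matrix B B ℂ) (_ : σ ∈ {σ : Matrix B B ℂ | IsState σ}) =>
    2 * log2 (ENNReal.ofReal (fidelity ρ ((1 : Matrix X X ℂ) ⊗ₖ σ)))) σ hσ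

theorem lenc_le {p : X → ℝ} {φ : X → Matrix B B ℂ} {ε : ℝ} {m : ℕ}
    (h : HasGoodProtocol p φ ε m) : lenc p φ ε ≤ ((m : ℝ) : EReal) :=
  iInf₂_le (f := fun (m : ℕ) (_ : m ∈ {m : ℕ | HasGoodProtocol p φ ε m}) => ((m : ℝ) : EReal)) m h

theorem HasGoodProtocol.mono {p : X → ℝ} {φ : X → Matrix B B ℂ} {ε ε' : ℝ} {m : ℕ}
    (h : HasGoodProtocol p φ ε m) (hε : ε ≤ ε') : HasGoodProtocol p φ ε' m := by
  obtain ⟨E, Λ, hΛ, hE⟩ := h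
  exact ⟨E, Λ, hΛ, hE.trans hε⟩

/-- For the case `ε₂ = 0`: there the right-hand side of the achievability bound contains `⊤`, and `⊥
+ ⊤ = ⊥` in `EReal`. -/
theorem hmaxSmooth_ne_bot {p : X → ℝ} {φ : X → Matrix B B ℂ} (hp : ∀ x, 0 ≤ p x)
    (hp_sum : ∑ x, p x = 1) (hφ : ∀ x, IsState (φ x)) {ε₁ : ℝ} (h0 : 0 ≤ ε₁) (h1 : ε₁ < 1) :
    hmaxSmooth ε₁ (cqState p φ) ≠ ⊥ := by
  have hpos : 0 < √(1 - ε₁ ^ 2) := Real.sqrt_pos.mpr (by nlinarith)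
  refine ne_bot_of_le_ne_bot (EReal.coe_ne_bot (2 * Real.logb 2 √(1 - ε₁ ^ 2))) ?_
  refine le_iInf₂ fun ρ hρ => ?_
  obtain ⟨σ, hσ, hf, -⟩ := exists_state_and_protocol hp hp_sum hφ h0 h1 hρ
  rw [← two_mul_log2_ofReal hpos]
  exact (two_mul_log2_mono (ENNReal.ofReal_le_ofReal hf)).trans (le_hmax ρ hσ)

theorem lenc_le_hmax_add {p : X → ℝ} {φ : X → Matrix B B ℂ} (hp : ∀ x, 0 ≤ p x)
    (hp_sum : ∑ x, p x = 1) (hφ : ∀ x, IsState (φ x)) {ε₁ ε₂ : ℝ} (h0 : 0 ≤ ε₁) (h1 : ε₁ < 1)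
    (h2 : 0 < ε₂) (h12 : ε₁ + ε₂ ≤ 1) {ρ : Matrix (X × B) (X × B) ℂ}
    (hρ : ρ ∈ smoothBall ε₁ (cqState p φ)) :
    lenc p φ (ε₁ + ε₂) ≤ hmax ρ + ((2 * Real.logb 2 (1 / ε₂) + 4 : ℝ) : EReal) := by
  obtain ⟨σ, hσ, hf, hgood⟩ := exists_state_and_protocol hp hp_sum hφ h0 h1 hρ
  have hle := le_hmax ρ hσ
  set f := fidelity ρ ((1 : Matrix X X ℂ) ⊗ₖ σ)
  have hε : 0 < 1 - ε₁ ^ 2 := by nlinarith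
  have hf0 : 0 < f := (Real.sqrt_pos.mpr hε).trans_le hf
  have hf2 : 1 - ε₁ ^ 2 ≤ f ^ 2 := (Real.sqrt_le_left hf0.le).mp hf
  rw [two_mul_log2_ofReal hf0] at hle
  -- `2 √(2/2^m) f ≤ ε₂` amounts to `2^m ≥ 8 f²/ε₂²`. The constant `4` is `log₂ 8 = 3` plus one for
  -- rounding up.
  have hR : 0 < 8 * f ^ 2 / ε₂ ^ 2 := by positivity
  have hlog : Real.logb 2 (8 * f ^ 2 / ε₂ ^ 2)
      = 2 * Real.logb 2 f + 2 * Real.logb 2 (1 / ε₂) + 3 := by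
    rw [Real.logb_div (by positivity) (by positivity), Real.logb_mul (by norm_num) (by positivity),
      Real.logb_pow, Real.logb_pow, one_div, Real.logb_inv, show (8 : ℝ) = 2 ^ 3 by norm_num,
      Real.logb_pow, Real.logb_self_eq_one one_lt_two]
    push_cast
    ring
  -- `f² ≥ 1 - ε₁² ≥ 1 - ε₁ ≥ ε₂ ≥ ε₂²`. Without nonnegativity the natural-number ceiling could
  -- exceed its argument by more than one.
  have hy0 : 0 ≤ Real.logb 2 (8 * f ^ 2 / ε₂ ^ 2) := by
    refine Real.logb_nonneg one_lt_two ?_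
    rw [le_div_iff₀ (by positivity)]
    nlinarith
  set m := ⌈Real.logb 2 (8 * f ^ 2 / ε₂ ^ 2)⌉₊ with hm
  have hm1 : 8 * f ^ 2 / ε₂ ^ 2 ≤ 2 ^ m := by
    rw [← Real.rpow_natCast 2 m, ← Real.logb_le_iff_le_rpow one_lt_two hR]
    exact Nat.le_ceil _
  have hm2 : (m : ℝ) < Real.logb 2 (8 * f ^ 2 / ε₂ ^ 2) + 1 := Nat.ceil_lt_add_one hy0
  have herr : 2 * √(2 / 2 ^ m) * f ≤ ε₂ := by
    have h3 : 2 / 2 ^ m ≤ (ε₂ / (2 * f)) ^ 2 := by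
      rw [div_le_iff₀ (by positivity)] at hm1 ⊢
      rw [div_pow, div_mul_eq_mul_div, le_div_iff₀ (by positivity)]
      nlinarith
    have h4 : √(2 / 2 ^ m) ≤ ε₂ / (2 * f) := Real.sqrt_le_iff.mpr ⟨by positivity, h3⟩
    rw [le_div_iff₀ (by positivity)] at h4
    linarith
  refine (lenc_le ((hgood m).mono (by linarith))).trans ?_
  refine le_trans ?_ (add_le_add_left hle _)
  rw [← EReal.coe_add, EReal.coe_le_coe_iff]
  linarith

theorem lenc_le_hmaxSmooth_add {p : X → ℝ} {φ : X → Matrix B B ℂ} (hp : ∀ x, 0 ≤ p x)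
    (hp_sum : ∑ x, p x = 1) (hφ : ∀ x, IsState (φ x)) {ε₁ ε₂ : ℝ} (h0 : 0 ≤ ε₁) (h1 : ε₁ < 1)
    (h2 : 0 ≤ ε₂) (h12 : ε₁ + ε₂ ≤ 1) :
    lenc p φ (ε₁ + ε₂) ≤
      hmaxSmooth ε₁ (cqState p φ) + 2 * log2 (1 / ENNReal.ofReal ε₂) + 4 := by
  have h4 : (4 : EReal) = ((4 : ℝ) : EReal) := rfl
  rcases h2.eq_or_lt with rfl | h2
  · have htop : (2 : EReal) * ⊤ = ⊤ := EReal.mul_top_of_pos (by norm_num)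
    rw [ENNReal.ofReal_zero, ENNReal.div_zero one_ne_zero, log2_top, htop,
      EReal.add_top_of_ne_bot (hmaxSmooth_ne_bot hp hp_sum hφ h0 h1), h4, EReal.top_add_coe]
    exact le_top
  · rw [show (1 : ℝ≥0∞) / ENNReal.ofReal ε₂ = ENNReal.ofReal (1 / ε₂) by
      rw [ENNReal.ofReal_div_of_pos h2, ENNReal.ofReal_one], two_mul_log2_ofReal (by positivity),
      add_assoc, h4, ← EReal.coe_add]
    -- Moving the finite constant to the left exposes the infimum, so each `ρ` in the ball can be
    -- treated separately.
    rw [← EReal.sub_le_iff_le_add (Or.inl (EReal.coe_ne_bot _)) (Or.inl (EReal.coe_ne_top _))]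
    refine le_iInf₂ fun ρ hρ => ?_
    rw [EReal.sub_le_iff_le_add (Or.inl (EReal.coe_ne_bot _)) (Or.inl (EReal.coe_ne_top _))]
    exact lenc_le_hmax_add hp hp_sum hφ h0 h1 h2 h12 hρ

theorem hmaxSmooth_le_lenc {p : X → ℝ} {φ : X → Matrix B B ℂ} (hp : ∀ x, 0 ≤ p x)
    (hp_sum : ∑ x, p x = 1) (hφ : ∀ x, IsState (φ x)) {ε : ℝ} (hε : 0 ≤ ε) :
    hmaxSmooth √(2 * ε) (cqState p φ) ≤ lenc p φ ε := by
  refine le_iInf₂ fun m hm => ?_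
  obtain ⟨E, Λ, hΛ, hE⟩ := hm
  obtain ⟨ρ, hρ, hF, hub⟩ := exists_near_fidelity_le (E := E) hp hp_sum hφ hΛ
  have hF0 := fidelity_nonneg (cqState p φ) ρ
  have hball : ρ ∈ smoothBall √(2 * ε) (cqState p φ) := by
    refine ⟨hρ, Real.sqrt_le_sqrt ?_⟩
    -- For `ε ≤ 1`, `1 - F² ≤ 1 - (1 - ε)² ≤ 2ε`; for `ε ≥ 1` the bound is trivial.
    rcases le_total ε 1 with h | h <;> nlinarith
  refine (iInf₂_le ρ hball).trans (iSup₂_le fun σ hσ => ?_)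
  refine (two_mul_log2_mono (ENNReal.ofReal_le_ofReal (hub σ hσ))).trans ?_
  rw [two_mul_log2_ofReal (Real.sqrt_pos.mpr (by exact_mod_cast Fintype.card_pos)),
    EReal.coe_le_coe_iff, Real.sqrt_eq_rpow, Real.logb_rpow_eq_mul_logb_of_pos
      (by exact_mod_cast Fintype.card_pos)]
  simp [Real.logb_pow]

end Main

end CQCompression

open CQCompression in
theorem theorem1 {X B : Type*} [Fintype X] [DecidableEq X] [Fintype B] [DecidableEq B]
    (p : X → ℝ) (φ : X → Matrix B B ℂ)
    (hp : ∀ x, 0 ≤ p x) (hp_sum : ∑ x, p x = 1) (hφ : ∀ x, IsState (φ x))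
    (ε : ℝ) (hε : 0 ≤ ε) :
    (∀ ε₁ ε₂ : ℝ, 0 ≤ ε₁ → 0 ≤ ε₂ → ε = ε₁ + ε₂ → ε ≤ 1 → ε₁ < 1 →
      lenc p φ ε ≤
        hmaxSmooth ε₁ (cqState p φ) + 2 * log2 (1 / ENNReal.ofReal ε₂) + 4) ∧
    hmaxSmooth (Real.sqrt (2 * ε)) (cqState p φ) ≤ lenc p φ ε := by
  refine ⟨?_, hmaxSmooth_le_lenc hp hp_sum hφ hε⟩
  rintro ε₁ ε₂ h0 h2 rfl h12 h1
  exact lenc_le_hmaxSmooth_add hp hp_sum hφ h0 h1 h2 h12
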